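/- A topological graph $E=(E^0,E^1,r,s)$ consists of locally compact Hausdorff spaces $E^0,E^1$, a continuous map $r:E^1\to E^0$ and a local homeomorphism $s:E^1\to E^0$. For $n\ge 1$ let $E^n=\{(\mu_1,\dots,\mu_n)\in (E^1)^n: s(\mu_i)=r(\mu_{i+1}) \text{ for } 1\le i<n\}$ with the subspace topology, $r^n(\mu)=r(\mu_1)$, $s^n(\mu)=s(\mu_n)$. A path $\mu\in E^n$ is a cycle with base point $r^n(\mu)$ if $r^n(\mu)=s^n(\mu)$; it has an entrance if for some $i$ there is an edge $e\ne\mu_i$ with $r(e)=r(\mu_i)$. Let $V_n$ be the set of all $v\in E^0$ that have an open neighbourhood consisting of base points of cycles without entrances in $E^n$. Let $B^n$ be the set of all cycles $\mu\in E^n$ for which there are $k\ge1$ and an open neighbourhood $N$ of $\mu$ in $E^n$ such that, writing $kN$ for the set of paths $\alpha=\alpha^{(1)}\cdots\alpha^{(k)}\in E^{kn}$ with all $\alpha^{(j)}\in N$, and $s(\alpha)=s^n(\alpha^{(k)})$: 1. for any distinct $\alpha,\beta\in kN$ there is no $\gamma\in N$ with $r^n(\gamma)=s(\alpha)$ and $s^n(\gamma)=s(\beta)$;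 2. for any $\alpha\in kN$, no cycle in $N$ with base point $s(\alpha)$ has an entrance. Let $E^0_{\mathrm{fin}}$ be the set of $v\in E^0$ with an open neighbourhood $U$ such that $r^{-1}(\overline U)$ is compact, let $E^0_{\mathrm{sce}}=E^0\setminus\overline{r(E^1)}$, and let $E^0_{\mathrm{sg}}=E^0\setminus\big(E^0_{\mathrm{fin}}\setminus\overline{E^0_{\mathrm{sce}}}\big)$ be the set of singular vertices. Let $E^\infty=\{x\in\prod_{i\ge1}E^1: s(x_i)=r(x_{i+1})\text{ for all } i\}$ with the subspace topology of the product, let $\sigma(x_1x_2\cdots)=x_2x_3\cdots$, and let $$\Gamma(E^\infty,\sigma)=\{(x,k-\ell,y)\in E^\infty\times\mathbb Z\times E^\infty: k,\ell\ge 0,\ \sigma^k(x)=\sigma^\ell(y)\}$$ with range $x$ and source $y$, and with the topology generated by the sets $\{(x,k-\ell,y):x\in U,\ y\in W,\ \sigma^k(x)=\sigma^\ell(y)\}$, where $U,W\subseteq E^\infty$ are open, $\sigma^k$ is injective on $U$ and $\sigma^\ell$ is injective on $W$. Let $\mathrm{Iso}(\Gamma(E^\infty,\sigma))^{\mathrm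 o}$ be the interior of the set of its elements whose range and source agree. **Theorem.** Let $E$ be a topological graph. For every $n\ge1$, $r^n(B^n)=V_n$ and $B^n=(r^n)^{-1}(V_n)$; hence $B^n$ is an open subset of $E^n$. Suppose furthermore that $E^0_{\mathrm{sg}}=\varnothing$. Then, for every $n\ge1$, $B^n$ is closed in $E^n$ if and only if $V_n$ is closed in $E^0$. If these sets are closed for all $n\ge1$, then $\mathrm{Iso}(\Gamma(E^\infty,\sigma))^{\mathrm o}$ is closed in $\Gamma(E^\infty,\sigma)$. -/

import Mathlib

open Topology

/-- A topological graph `(E⁰, E¹, r, s)`: two locally compact Hausdorff spaces (of vertices and of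
edges), a continuous range map `r` and a source map `s` which is a local homeomorphism. -/
structure TopologicalGraph (V E : Type*) [TopologicalSpace V] [LocallyCompactSpace V] [T2Space V]
    [TopologicalSpace E] [LocallyCompactSpace E] [T2Space E] where
  r : E → V
  s : E → V
  continuous_r : Continuous r
  isLocalHomeomorph_s : IsLocalHomeomorph s

namespace TopologicalGraph

variable {V E : Type*} [TopologicalSpace V] [LocallyCompactSpace V] [T2Space V]
  [TopologicalSpace E] [LocallyCompactSpace E] [T2Space E] (G : TopologicalGraph V E)

/-- The finite receivers: vertices with an open neighbourhood `N` such that the preimage under `r`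
of the closure of `N` is compact. -/
def finiteReceivers : Set V :=
  {v | ∃ N : Set V, IsOpen N ∧ v ∈ N ∧ IsCompact (G.r ⁻¹' closure N)}

/-- The sources: the complement of the closure of the image of `r`. -/
def sourceVertices : Set V := (closure (Set.range G.r))ᶜ

/-- The regular vertices. -/
def regularVertices : Set V := G.finiteReceivers \ closure G.sourceVertices

/-- The singular vertices. -/
def singularVertices : Set V := G.regularVerticesᶜ

/-- The space `Eⁿ` of paths `μ₁ ⋯ μₙ` of length `n ≥ 1`, with `s μᵢ = r μᵢ₊₁`, as a subspace of
the `n`-fold product of the edge space. (It is only used for `n ≥ 1`.) -/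
abbrev Path (n : ℕ) : Type _ :=
  {μ : Fin n → E // ∀ (i : ℕ) (hi : i + 1 < n),
    G.s (μ ⟨i, Nat.lt_of_succ_lt hi⟩) = G.r (μ ⟨i + 1, hi⟩)}

/-- The range map `rⁿ : Eⁿ → E⁰`, `μ₁ ⋯ μₙ ↦ r μ₁`. -/
def pathRange {n : ℕ} [NeZero n] (μ : G.Path n) : V := G.r (μ.1 0)

/-- The source map `sⁿ : Eⁿ → E⁰`, `μ₁ ⋯ μₙ ↦ s μₙ`. -/
def pathSource {n : ℕ} [NeZero n] (μ : G.Path n) : V :=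
  G.s (μ.1 ⟨n - 1, Nat.sub_one_lt (NeZero.ne n)⟩)

/-- A path is a cycle if its range and its source agree; that vertex is its base point. -/
def IsCycle {n : ℕ} [NeZero n] (μ : G.Path n) : Prop := G.pathRange μ = G.pathSource μ

/-- A cycle `μ₁ ⋯ μₙ` has an entrance if, for some `i`, an edge other than `μᵢ` has range `r μᵢ`. -/
def HasEntrance {n : ℕ} (μ : G.Path n) : Prop :=
  ∃ (i : Fin n) (e : E), G.r e = G.r (μ.1 i) ∧ e ≠ μ.1 i

/-- For `N ⊆ Eⁿ`, the paths `α = α⁽¹⁾ ⋯ α⁽ᵏ⁾` in `kN = N × ⋯ × N`, written as the tuples of their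
`k` consecutive segments `α⁽ʲ⁾ ∈ N`. -/
def power {n : ℕ} [NeZero n] (k : ℕ) (N : Set (G.Path n)) : Set (Fin k → G.Path n) :=
  {α | (∀ j, α j ∈ N) ∧ ∀ (j : ℕ) (hj : j + 1 < k),
    G.pathSource (α ⟨j, Nat.lt_of_succ_lt hj⟩) = G.pathRange (α ⟨j + 1, hj⟩)}

/-- The source of a path `α⁽¹⁾ ⋯ α⁽ᵏ⁾`, that is, the source of its last segment. -/
def powerSource {n k : ℕ} [NeZero n] [NeZero k] (α : Fin k → G.Path n) : V :=
  G.pathSource (α ⟨k - 1, Nat.sub_one_lt (NeZero.ne k)⟩)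

/-- The set `Bⁿ` of the cycles `μ` of length `n` for which there are `k ≥ 1` and an open
neighbourhood `N` of `μ` in `Eⁿ` such that no path in `N` connects `s α` and `s β` for distinct
`α`, `β` in `kN`, and no cycle in `N` with base point `s α`, for `α` in `kN`, has an entrance. -/
def B (n : ℕ) [NeZero n] : Set (G.Path n) :=
  {μ | G.IsCycle μ ∧ ∃ (k : ℕ) (_ : NeZero k) (N : Set (G.Path n)), IsOpen N ∧ μ ∈ N ∧
    (∀ α ∈ G.power k N, ∀ β ∈ G.power k N, α ≠ β →
      ¬ ∃ γ ∈ N, G.pathRange γ = G.powerSource α ∧ G.pathSource γ = G.powerSource β) ∧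
    (∀ α ∈ G.power k N,
      ¬ ∃ γ ∈ N, G.IsCycle γ ∧ G.HasEntrance γ ∧ G.pathRange γ = G.powerSource α)}

/-- The set `Vₙ` of the vertices with an open neighbourhood consisting of base points of cycles
of length `n` without entrances. -/
def cycleVertices (n : ℕ) [NeZero n] : Set V :=
  {v | ∃ W : Set V, IsOpen W ∧ v ∈ W ∧
    ∀ w ∈ W, ∃ γ : G.Path n, G.IsCycle γ ∧ ¬ G.HasEntrance γ ∧ G.pathRange γ = w}

/-- The infinite path space `E^∞`, as a subspace of the product of countably many copies of the
edge space. -/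
abbrev InfinitePath : Type _ := {x : ℕ → E // ∀ i, G.s (x i) = G.r (x (i + 1))}

/-- The one-sided shift `x₁x₂x₃⋯ ↦ x₂x₃⋯`. -/
def shift (x : G.InfinitePath) : G.InfinitePath := ⟨fun i => x.1 (i + 1), fun i => x.2 (i + 1)⟩

/-- The boundary path groupoid `Γ(E^∞, σ)` of a topological graph without singular vertices: the
triples `(x, k - l, y)` with `σᵏ x = σˡ y`, with range `x` and source `y` (the product of
`(x, m, y)` and `(y, m', z)` is `(x, m + m', z)`, the inverse of `(x, m, y)` is `(y, -m, x)`). -/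
@[ext]
structure BoundaryPathGroupoid where
  range : G.InfinitePath
  degree : ℤ
  source : G.InfinitePath
  exists_shift_eq : ∃ k l : ℕ, degree = (k : ℤ) - l ∧ G.shift^[k] range = G.shift^[l] source

/-- The set `𝒰(U, W, k, l) = {(x, k - l, y) : x ∈ U, y ∈ W, σᵏ x = σˡ y}`. -/
def basicOpen (U W : Set G.InfinitePath) (k l : ℕ) : Set G.BoundaryPathGroupoid :=
  {g | g.range ∈ U ∧ g.source ∈ W ∧ g.degree = (k : ℤ) - l ∧
    G.shift^[k] g.range = G.shift^[l] g.source}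

/-- The topology generated by the sets `𝒰(U, W, k, l)`, where `U` and `W` are open, `σᵏ` is
injective on `U`, and `σˡ` is injective on `W`. -/
instance : TopologicalSpace G.BoundaryPathGroupoid :=
  TopologicalSpace.generateFrom
    {A | ∃ (U W : Set G.InfinitePath) (k l : ℕ), IsOpen U ∧ IsOpen W ∧
      Set.InjOn (G.shift^[k]) U ∧ Set.InjOn (G.shift^[l]) W ∧ A = G.basicOpen U W k l}

/-- The isotropy group bundle `Iso(Γ(E^∞, σ))`. -/
def isotropy : Set G.BoundaryPathGroupoid := {g | g.range = g.source}

end TopologicalGraph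

/-!
Write `Eⁿ`, `Bⁿ`, `Vₙ`, `σ` for the path spaces, the sets `G.B n` and `G.cycleVertices n`, and the
shift.

*The equality `Bⁿ = (rⁿ)⁻¹(Vₙ)`.* A path whose range is the base point of a cycle without entrances
is that cycle (`eq_of_not_hasEntrance`). Hence if `rⁿ μ` has a neighbourhood `W` of such base
points, then `k = 1` and `N = (rⁿ)⁻¹(W)` witness `μ ∈ Bⁿ`. Conversely, let `k` and `N` witness
`μ ∈ Bⁿ`. As `s` is open, so is the set `W` of the sources of the paths in `kN`
(`isOpen_chainSources`), and every vertex in the neighbourhood `sⁿ(N ∩ (rⁿ)⁻¹(W)) ∩ W` of `rⁿ μ` is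
the source of some `γ ∈ N` that runs from the source of some `α ∈ kN` to the source of some
`β ∈ kN`. The first condition forces `α = β`, so `γ` is a cycle, and the second one says that it has
no entrance.

*Graphs without singular vertices.* Here `r` is proper and surjective (`isProperMap_r`,
`surjective_r`), hence `rⁿ` is proper, in particular closed, so `Bⁿ` is closed if and only if `Vₙ`
is.

*The interior of the isotropy.* Let `g = (x, n, x)` with `n ≥ 1` and `σˡ⁺ⁿ x = σˡ x`. Then `g` is in
the interior of the isotropy if and only if `r (σˡ x) ∈ Vₙ`. If `r (σˡ x) ∈ Vₙ`, then `σˡ x'` is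
`n`-periodic for all `x'` near `x`, so that `σˡ⁺ⁿ x' = σˡ y'` gives `σˡ x' = σˡ y'`, and `x' = y'` by
local injectivity of `σˡ` (`mem_interior_isotropy_of_r_mem_cycleVertices`). If `g` is in the
interior, then, `σ` being open, all paths near `σˡ x` are `n`-periodic; an entrance to one of the
corresponding cycles would, after sufficiently many turns, lead to a nearby path which is not
periodic, so `r (σˡ x) ∈ Vₙ` (`mem_cycleVertices_of_forall_iterate_shift_eq`). If `Vₙ` is closed,
the criterion passes to limits, since `l` can be kept fixed near `g`. Elements of degree zero
are units, which form an open set, and negative degrees are reduced to positive ones by the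
inverse.
-/

namespace TopologicalGraph

/-- The sources of the chains `f 0, …, f j` with `f i ∈ U i` form an open set. This is used both for
paths, as chains of edges, and for the paths in `kN`, as chains of paths in `N`. -/
theorem isOpen_chainSources {X V : Type*} [TopologicalSpace X] [TopologicalSpace V] {r s : X → V}
    (hr : Continuous r) (hs : IsOpenMap s) {U : ℕ → Set X} (hU : ∀ i, IsOpen (U i)) (j : ℕ) :
    IsOpen {v | ∃ f : ℕ → X, (∀ i < j, s (f i) = r (f (i + 1))) ∧ (∀ i ≤ j, f i ∈ U i) ∧
      s (f j) = v} := by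
  induction j with
  | zero =>
    convert hs _ (hU 0) using 1
    ext v
    constructor
    · rintro ⟨f, -, hf, rfl⟩
      exact ⟨f 0, hf 0 le_rfl, rfl⟩
    · rintro ⟨e, he, rfl⟩
      exact ⟨fun _ => e, by simp, by simpa using he, rfl⟩
  | succ j ih =>
    convert hs _ ((hU (j + 1)).inter (ih.preimage hr)) using 1
    ext v
    constructor
    · rintro ⟨f, hf, hfU, rfl⟩
      exact ⟨f (j + 1), ⟨hfU _ le_rfl, f, fun i hi => hf i (by omega), fun i hi => hfU i (by omega),
        hf j (by omega)⟩, rfl⟩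
    · rintro ⟨e, ⟨heU, f, hf, hfU, hfe⟩, rfl⟩
      refine ⟨fun i => if i ≤ j then f i else e, fun i hi => ?_, fun i hi => ?_, by simp⟩
      · rcases (Nat.lt_succ_iff.1 hi).lt_or_eq with h | rfl
        · simpa [h.le, Nat.succ_le_of_lt h] using hf i h
        · simpa using hfe
      · rcases hi.lt_or_eq with h | rfl
        · simpa [Nat.lt_succ_iff.1 h] using hfU i (Nat.lt_succ_iff.1 h)
        · simpa using heU

variable {V E : Type*} [TopologicalSpace V] [LocallyCompactSpace V] [T2Space V]
  [TopologicalSpace E] [LocallyCompactSpace E] [T2Space E] {G : TopologicalGraph V E}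

/-! ### Finite paths -/

theorem continuous_pathRange {n : ℕ} [NeZero n] : Continuous (G.pathRange (n := n)) :=
  G.continuous_r.comp ((continuous_apply _).comp continuous_subtype_val)

theorem isOpenMap_pathSource {n : ℕ} [NeZero n] : IsOpenMap (G.pathSource (n := n)) := by
  rintro _ ⟨O, hO, rfl⟩
  rw [isOpen_iff_mem_nhds]
  rintro _ ⟨μ, hμ, rfl⟩
  obtain ⟨U, hU, hUO⟩ := isOpen_pi_iff'.1 hO μ.1 hμ
  have hn : 0 < n := NeZero.pos n
  have key := isOpen_chainSources G.continuous_r G.isLocalHomeomorph_s.isOpenMap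
    (U := fun i => if h : i < n then U ⟨i, h⟩ else Set.univ)
    (fun i => by split_ifs with h; exacts [(hU _).1, isOpen_univ]) (n - 1)
  refine Filter.mem_of_superset (key.mem_nhds
    ⟨fun i => if h : i < n then μ.1 ⟨i, h⟩ else μ.1 0, fun i hi => ?_, fun i hi => ?_, ?_⟩) ?_
  · have h1 : i + 1 < n := by omega
    simpa [h1, Nat.lt_of_succ_lt h1] using μ.2 i h1
  · have h1 : i < n := by omega
    simpa [h1] using (hU ⟨i, h1⟩).2
  · simp [pathSource, hn]
  · rintro _ ⟨f, hf, hfU, rfl⟩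
    refine ⟨⟨fun i => f i, fun i hi => hf i (by omega)⟩, hUO fun i _ => ?_, rfl⟩
    have := hfU i (by omega)
    simpa using this

/-- A path without entrances is the only path of its length with its range: each edge is determined
by its range, hence by the preceding edge. -/
theorem eq_of_not_hasEntrance {n : ℕ} [NeZero n] {γ μ : G.Path n} (hγ : ¬ G.HasEntrance γ)
    (h : G.pathRange μ = G.pathRange γ) : μ = γ := by
  have step : ∀ (i : Fin n) (e : E), G.r e = G.r (γ.1 i) → e = γ.1 i := by
    simpa [HasEntrance] using hγ
  have key : ∀ (i : ℕ) (hi : i < n), μ.1 ⟨i, hi⟩ = γ.1 ⟨i, hi⟩ := by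
    intro i
    induction i with
    | zero => exact fun hi => step _ _ h
    | succ i ih =>
      intro hi
      apply step
      rw [← μ.2 i hi, ← γ.2 i hi, ih]
  exact Subtype.ext (funext fun i => key i i.2)

theorem isOpen_cycleVertices (n : ℕ) [NeZero n] : IsOpen (G.cycleVertices n) := by
  rw [isOpen_iff_mem_nhds]
  rintro v ⟨W, hW, hvW, h⟩
  exact Filter.mem_of_superset (hW.mem_nhds hvW) fun w hw => ⟨W, hW, hw, h⟩

theorem pathRange_mem_cycleVertices_of_mem_B {n : ℕ} [NeZero n] {μ : G.Path n} (hμ : μ ∈ G.B n) :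
    G.pathRange μ ∈ G.cycleVertices n := by
  obtain ⟨hc, k, hk, N, hN, hμN, h1, h2⟩ := hμ
  have hk' : 0 < k := NeZero.pos k
  have hW := isOpen_chainSources continuous_pathRange isOpenMap_pathSource (fun _ => hN) (k - 1)
  set W := {v | ∃ f : ℕ → G.Path n, (∀ i < k - 1, G.pathSource (f i) = G.pathRange (f (i + 1))) ∧
    (∀ i ≤ k - 1, f i ∈ N) ∧ G.pathSource (f (k - 1)) = v}
  -- `W` is the set of the sources of the paths in `kN`.
  have hpow : ∀ w ∈ W, ∃ α ∈ G.power k N, G.powerSource α = w := by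
    rintro _ ⟨f, hf, hfN, rfl⟩
    exact ⟨fun j => f j, ⟨fun j => hfN j (by omega), fun j hj => hf j (by omega)⟩, rfl⟩
  have hrW : G.pathRange μ ∈ W := ⟨fun _ => μ, fun _ _ => hc.symm, fun _ _ => hμN, hc.symm⟩
  refine ⟨G.pathSource '' (N ∩ G.pathRange ⁻¹' W) ∩ W,
    (isOpenMap_pathSource _ (hN.inter (hW.preimage continuous_pathRange))).inter hW,
    ⟨⟨μ, ⟨hμN, hrW⟩, hc.symm⟩, hrW⟩, ?_⟩
  rintro _ ⟨⟨γ, ⟨hγN, hγW⟩, rfl⟩, hsW⟩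
  obtain ⟨α, hα, hαγ⟩ := hpow _ hγW
  obtain ⟨β, hβ, hβγ⟩ := hpow _ hsW
  obtain rfl : α = β := by
    by_contra hne
    exact h1 α hα β hβ hne ⟨γ, hγN, hαγ.symm, hβγ.symm⟩
  have hγ : G.IsCycle γ := hαγ.symm.trans hβγ
  exact ⟨γ, hγ, fun he => h2 α hα ⟨γ, hγN, hγ, he, hαγ.symm⟩, hγ⟩

theorem mem_B_of_pathRange_mem_cycleVertices {n : ℕ} [NeZero n] {μ : G.Path n}
    (hμ : G.pathRange μ ∈ G.cycleVertices n) : μ ∈ G.B n := by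
  obtain ⟨W, hW, hμW, h⟩ := hμ
  have key : ∀ ν : G.Path n, G.pathRange ν ∈ W → G.IsCycle ν ∧ ¬ G.HasEntrance ν := by
    intro ν hν
    obtain ⟨γ, hγ, hγe, hγν⟩ := h _ hν
    obtain rfl := eq_of_not_hasEntrance hγe hγν.symm
    exact ⟨hγ, hγe⟩
  refine ⟨(key μ hμW).1, 1, inferInstance, G.pathRange ⁻¹' W, hW.preimage continuous_pathRange,
    hμW, ?_, ?_⟩
  · rintro α ⟨hα, -⟩ β ⟨hβ, -⟩ hne ⟨γ, hγ, hγα, hγβ⟩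
    refine hne (funext fun j => ?_)
    obtain rfl : j = 0 := Subsingleton.elim _ _
    refine eq_of_not_hasEntrance (key _ (hβ 0)).2 ?_
    calc G.pathRange (α 0) = G.pathSource (α 0) := (key _ (hα 0)).1
      _ = G.pathRange γ := hγα.symm
      _ = G.pathSource γ := (key _ hγ).1
      _ = G.pathSource (β 0) := hγβ
      _ = G.pathRange (β 0) := (key _ (hβ 0)).1.symm
  · rintro α - ⟨γ, hγ, -, hγe, -⟩
    exact (key γ hγ).2 hγe

theorem B_eq_preimage (n : ℕ) [NeZero n] : G.B n = G.pathRange ⁻¹' G.cycleVertices n :=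
  Set.Subset.antisymm (fun _ => pathRange_mem_cycleVertices_of_mem_B)
    fun _ => mem_B_of_pathRange_mem_cycleVertices

theorem image_B (n : ℕ) [NeZero n] : G.pathRange '' G.B n = G.cycleVertices n := by
  rw [B_eq_preimage, Set.image_preimage_eq_iff]
  rintro v ⟨W, -, hvW, h⟩
  obtain ⟨γ, -, -, hγ⟩ := h v hvW
  exact ⟨γ, hγ⟩

/-! ### Graphs without singular vertices -/

theorem isProperMap_r (hG : G.singularVertices = ∅) : IsProperMap G.r := by
  have hreg : ∀ v, v ∈ G.regularVertices := fun v => by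
    by_contra h
    exact (Set.eq_empty_iff_forall_notMem.1 hG v) h
  refine isProperMap_iff_isCompact_preimage.2 ⟨G.continuous_r, fun K hK => ?_⟩
  obtain ⟨C, hC, hKC⟩ : ∃ C, IsCompact C ∧ G.r ⁻¹' K ⊆ C := by
    refine hK.induction_on (p := fun S => ∃ C, IsCompact C ∧ G.r ⁻¹' S ⊆ C)
      ⟨∅, isCompact_empty, by simp⟩ ?_ ?_ ?_
    · rintro S T hST ⟨C, hC, hTC⟩
      exact ⟨C, hC, (Set.preimage_mono hST).trans hTC⟩
    · rintro S T ⟨C, hC, hSC⟩ ⟨D, hD, hTD⟩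
      exact ⟨C ∪ D, hC.union hD, Set.union_subset_union hSC hTD⟩
    · intro v _
      obtain ⟨N, hN, hvN, hNc⟩ := (hreg v).1
      exact ⟨N, mem_nhdsWithin_of_mem_nhds (hN.mem_nhds hvN), _, hNc,
        Set.preimage_mono subset_closure⟩
  exact hC.of_isClosed_subset (hK.isClosed.preimage G.continuous_r) hKC

/-- The image of `r` is closed since `r` is proper, and dense since there are no sources. -/
theorem surjective_r (hG : G.singularVertices = ∅) : Function.Surjective G.r := by
  intro v
  have hv : v ∈ G.regularVertices := by
    by_contra h
    exact (Set.eq_empty_iff_forall_notMem.1 hG v) h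
  have h : v ∈ closure (Set.range G.r) :=
    Set.notMem_compl_iff.1 fun h => hv.2 (subset_closure h)
  rwa [(isProperMap_r hG).isClosedMap.isClosed_range.closure_eq] at h

theorem isClosedEmbedding_path (n : ℕ) :
    IsClosedEmbedding (Subtype.val : G.Path n → Fin n → E) := by
  have h : IsClosed {μ : Fin n → E | ∀ (i : ℕ) (hi : i + 1 < n),
      G.s (μ ⟨i, Nat.lt_of_succ_lt hi⟩) = G.r (μ ⟨i + 1, hi⟩)} := by
    simp only [Set.ofPred_forall]
    exact isClosed_iInter fun i => isClosed_iInter fun hi => isClosed_eq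
      (G.isLocalHomeomorph_s.continuous.comp (continuous_apply _))
      (G.continuous_r.comp (continuous_apply _))
  exact h.isClosedEmbedding_subtypeVal

theorem isProperMap_pathRange (hG : G.singularVertices = ∅) (n : ℕ) [NeZero n] :
    IsProperMap (G.pathRange (n := n)) := by
  refine isProperMap_iff_isCompact_preimage.2 ⟨continuous_pathRange, fun K hK => ?_⟩
  have hr := fun {C : Set V} (hC : IsCompact C) => (isProperMap_r hG).isCompact_preimage hC
  -- The `i`-th edge of a path with range in `K` lies in the compact set `C i`.
  let C : ℕ → Set E := fun i => Nat.rec (G.r ⁻¹' K) (fun _ D => G.r ⁻¹' (G.s '' D)) i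
  have hC : ∀ i, IsCompact (C i) := fun i => by
    induction i with
    | zero => exact hr hK
    | succ i ih => exact hr (ih.image G.isLocalHomeomorph_s.continuous)
  refine ((isClosedEmbedding_path n).isCompact_preimage
    (isCompact_univ_pi fun i : Fin n => hC i)).of_isClosed_subset
    (hK.isClosed.preimage continuous_pathRange) ?_
  intro μ hμ
  have key : ∀ (i : ℕ) (hi : i < n), μ.1 ⟨i, hi⟩ ∈ C i := by
    intro i
    induction i with
    | zero => exact fun _ => hμ
    | succ i ih => exact fun hi => ⟨_, ih _, μ.2 i hi⟩
  exact fun i _ => key i i.2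

theorem isClosed_B_iff (hG : G.singularVertices = ∅) (n : ℕ) [NeZero n] :
    IsClosed (G.B n) ↔ IsClosed (G.cycleVertices n) := by
  constructor
  · intro h
    rw [← image_B]
    exact (isProperMap_pathRange hG n).isClosedMap _ h
  · intro h
    rw [B_eq_preimage]
    exact h.preimage continuous_pathRange

/-! ### Infinite paths and the shift -/

theorem iterate_shift_apply (k : ℕ) (x : G.InfinitePath) (i : ℕ) :
    (G.shift^[k] x).1 i = x.1 (i + k) := by
  induction k generalizing x with
  | zero => rfl
  | succ k ih =>
    rw [Function.iterate_succ_apply, ih]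
    exact congrArg x.1 (by omega)

theorem continuous_infinitePath_apply (i : ℕ) : Continuous fun x : G.InfinitePath => x.1 i :=
  (continuous_apply i).comp continuous_subtype_val

theorem continuous_shift : Continuous G.shift :=
  Continuous.subtype_mk (continuous_pi fun i => continuous_infinitePath_apply (i + 1)) _

/-- The cylinder sets given by open conditions on finitely many edges form a neighbourhood basis
of each infinite path. -/
theorem exists_cylinder_subset {P : Set G.InfinitePath} (hP : IsOpen P) {x : G.InfinitePath}
    (hx : x ∈ P) : ∃ (U : ℕ → Set E) (m : ℕ), (∀ i, IsOpen (U i)) ∧ (∀ i, x.1 i ∈ U i) ∧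
      ∀ y : G.InfinitePath, (∀ i < m, y.1 i ∈ U i) → y ∈ P := by
  obtain ⟨O, hO, rfl⟩ := hP
  obtain ⟨I, U, hU, hUO⟩ := isOpen_pi_iff.1 hO x.1 hx
  classical
  refine ⟨fun i => if i ∈ I then U i else Set.univ, I.sup id + 1, fun i => ?_, fun i => ?_,
    fun y hy => hUO fun i hi => ?_⟩
  · dsimp only
    split_ifs with h
    exacts [(hU i h).1, isOpen_univ]
  · dsimp only
    split_ifs with h
    exacts [(hU i h).2, trivial]
  · have hi' : i ∈ I := hi
    simpa [hi'] using hy i (Nat.lt_succ_of_le (Finset.le_sup (f := id) hi'))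

/-- A finite path `f 0, …, f t` (of length `t + 1`) can be continued by an infinite path whose range
is its source. -/
theorem exists_append {f : ℕ → E} {t : ℕ} (hf : ∀ i < t, G.s (f i) = G.r (f (i + 1)))
    {y : G.InfinitePath} (hy : G.s (f t) = G.r (y.1 0)) :
    ∃ x : G.InfinitePath, (∀ i ≤ t, x.1 i = f i) ∧ ∀ i, x.1 (i + (t + 1)) = y.1 i := by
  refine ⟨⟨fun i => if i ≤ t then f i else y.1 (i - (t + 1)), fun i => ?_⟩, fun i hi => by simp [hi],
    fun i => ?_⟩
  · rcases lt_trichotomy i t with h | rfl | h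
    · simpa [h.le, Nat.succ_le_of_lt h] using hf i h
    · simpa using hy
    · have h1 : i + 1 - (t + 1) = i - (t + 1) + 1 := by omega
      simpa [h.not_ge, (h.trans (Nat.lt_succ_self i)).not_ge, h1] using y.2 (i - (t + 1))
  · have h1 : ¬ i + (t + 1) ≤ t := by omega
    simp [h1]

theorem exists_infinitePath (hr : Function.Surjective G.r) (e : E) :
    ∃ x : G.InfinitePath, x.1 0 = e := by
  choose g hg using hr
  exact ⟨⟨fun i => Nat.rec e (fun _ d => g (G.s d)) i, fun i => (hg _).symm⟩, rfl⟩

/-- The shift maps the cylinder of `U 0, U 1, …` onto the paths with range in `s (U 0)` that lie in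
the cylinder of `U 1, U 2, …`. -/
theorem isOpenMap_shift : IsOpenMap G.shift := by
  intro O hO
  rw [isOpen_iff_mem_nhds]
  rintro _ ⟨x, hx, rfl⟩
  obtain ⟨U, m, hU, hxU, hUO⟩ := exists_cylinder_subset hO hx
  have hopen : IsOpen ({y : G.InfinitePath | G.r (y.1 0) ∈ G.s '' U 0} ∩
      ⋂ i ∈ Set.Iio m, {y : G.InfinitePath | y.1 i ∈ U (i + 1)}) :=
    ((G.isLocalHomeomorph_s.isOpenMap _ (hU 0)).preimage
      (G.continuous_r.comp (continuous_infinitePath_apply 0))).inter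
      ((Set.finite_Iio m).isOpen_biInter fun i _ =>
        (hU (i + 1)).preimage (continuous_infinitePath_apply i))
  refine Filter.mem_of_superset (hopen.mem_nhds
    ⟨⟨x.1 0, hxU 0, x.2 0⟩, Set.mem_iInter₂.2 fun i _ => hxU (i + 1)⟩) ?_
  rintro y ⟨⟨e, he, hey⟩, hy⟩
  obtain ⟨z, hz0, hz⟩ := exists_append (f := fun _ => e) (t := 0) (by simp) hey
  refine ⟨z, hUO z fun i hi => ?_, Subtype.ext (funext hz)⟩
  cases i with
  | zero => rwa [hz0 0 le_rfl]
  | succ i =>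
    rw [hz i]
    exact Set.mem_iInter₂.1 hy i (Nat.lt_of_succ_lt hi)

theorem isOpenMap_iterate_shift (k : ℕ) : IsOpenMap G.shift^[k] := by
  induction k with
  | zero => exact IsOpenMap.id
  | succ k ih => exact ih.comp isOpenMap_shift

theorem exists_injOn_iterate_shift (k : ℕ) (x : G.InfinitePath) :
    ∃ U : Set G.InfinitePath, IsOpen U ∧ x ∈ U ∧ Set.InjOn G.shift^[k] U := by
  induction k generalizing x with
  | zero => exact ⟨Set.univ, isOpen_univ, trivial, Function.injective_id.injOn⟩
  | succ k ih =>
    obtain ⟨U, hU, hxU, hinj⟩ := ih (G.shift x)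
    obtain ⟨φ, hxφ, hφ⟩ := G.isLocalHomeomorph_s (x.1 0)
    refine ⟨{y | y.1 0 ∈ φ.source} ∩ G.shift ⁻¹' U,
      (φ.open_source.preimage (continuous_infinitePath_apply 0)).inter (hU.preimage continuous_shift),
      ⟨hxφ, hxU⟩, ?_⟩
    rw [Function.iterate_succ]
    refine hinj.comp (fun y hy z hz hyz => ?_) fun y hy => hy.2
    have h1 : ∀ i, y.1 (i + 1) = z.1 (i + 1) := fun i =>
      congrFun (congrArg Subtype.val hyz) i
    refine Subtype.ext (funext fun i => ?_)
    cases i with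
    | zero =>
      refine φ.injOn hy.1 hz.1 ?_
      rw [← hφ, y.2 0, z.2 0, h1]
    | succ i => exact h1 i

/-! ### Periodic infinite paths -/

/-- An infinite path which starts at the base point of a cycle without entrances can only run
around this cycle. -/
theorem iterate_shift_eq_self_of_mem_cycleVertices {n : ℕ} [NeZero n] {x : G.InfinitePath}
    (hx : G.r (x.1 0) ∈ G.cycleVertices n) : G.shift^[n] x = x := by
  obtain ⟨W, -, hxW, h⟩ := hx
  obtain ⟨γ, hγ, hγe, hγx⟩ := h _ hxW
  have hn : 0 < n := NeZero.pos n
  have step : ∀ (i : Fin n) (e : E), G.r e = G.r (γ.1 i) → e = γ.1 i := by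
    simpa [HasEntrance] using hγe
  have key : ∀ i, x.1 i = γ.1 ⟨i % n, Nat.mod_lt i hn⟩ := by
    intro i
    induction i with
    | zero =>
      apply step
      simpa [pathRange, Fin.ext_iff] using hγx.symm
    | succ i ih =>
      apply step
      rw [← x.2 i, ih]
      rcases (Nat.succ_le_of_lt (Nat.mod_lt i hn)).lt_or_eq with h1 | h1
      · have h2 : (i + 1) % n = i % n + 1 := by
          rw [Nat.add_mod_eq_ite, Nat.mod_eq_of_lt (show 1 < n by omega), if_neg (by omega)]
        simpa only [h2] using γ.2 (i % n) h1
      · have h2 : (i + 1) % n = 0 := by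
          rw [← Nat.mod_add_mod, ← Nat.succ_eq_add_one, h1, Nat.mod_self]
        have h3 : i % n = n - 1 := by omega
        simp only [h2, h3]
        exact hγ.symm
  refine Subtype.ext (funext fun i => ?_)
  rw [iterate_shift_apply, key, key]
  simp only [Nat.add_mod_right]

theorem apply_add_mul {n : ℕ} {x : G.InfinitePath} (hx : G.shift^[n] x = x) (i c : ℕ) :
    x.1 (i + n * c) = x.1 i := by
  induction c with
  | zero => rfl
  | succ c ih =>
    rw [Nat.mul_succ, ← Nat.add_assoc, ← iterate_shift_apply, hx, ih]

/-- If all infinite paths near `q` are `n`-periodic, then the initial segment of `q` of length `n` is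
a cycle without entrances. -/
theorem exists_cycle_of_forall_iterate_shift_eq (hr : Function.Surjective G.r) {n : ℕ} [NeZero n]
    {P : Set G.InfinitePath} (hP : IsOpen P) (hper : ∀ p ∈ P, G.shift^[n] p = p)
    {q : G.InfinitePath} (hq : q ∈ P) :
    ∃ γ : G.Path n, G.IsCycle γ ∧ ¬ G.HasEntrance γ ∧ G.pathRange γ = G.r (q.1 0) := by
  have hn : 0 < n := NeZero.pos n
  have hqn := hper q hq
  refine ⟨⟨fun i => q.1 i, fun i _ => q.2 i⟩, ?_, ?_, rfl⟩
  · change G.r (q.1 0) = G.s (q.1 (n - 1))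
    rw [q.2, Nat.sub_add_cancel hn, ← apply_add_mul hqn 0 1]
    simp
  · rintro ⟨i, e, he, hne⟩
    change G.r e = G.r (q.1 i) at he
    obtain ⟨U, m, -, hqU, hUP⟩ := exists_cylinder_subset hP hq
    obtain ⟨y, rfl⟩ := exists_infinitePath hr e
    -- Go around the cycle `m + 1` times, follow it up to its `i`-th edge, and leave through the
    -- entrance `e`: the path `x` so obtained agrees with `q` on its first `m` edges.
    have hm : m + 1 ≤ n * (m + 1) := Nat.le_mul_of_pos_left _ hn
    obtain ⟨t, ht⟩ : ∃ t, t + 1 = i + n * (m + 1) := ⟨i + n * (m + 1) - 1, by omega⟩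
    obtain ⟨x, hxq, hxy⟩ := exists_append (f := q.1) (t := t) (fun i _ => q.2 i) (y := y) (by
      rw [q.2, ht, apply_add_mul hqn, he])
    have hx := hper x (hUP x fun j hj => by rw [hxq j (by omega)]; exact hqU j)
    apply hne
    change y.1 0 = q.1 i
    rw [← hxq i (by omega), ← hxy 0, zero_add, ht, apply_add_mul hx]

/-- If all infinite paths near `q` are `n`-periodic, then the range of `q` is in `Vₙ`. The range map
on infinite paths need not be open, but at a multiple `t + 1` of the period the range of an
`n`-periodic path is the source of its edge number `t`, and source maps are open. -/
theorem mem_cycleVertices_of_forall_iterate_shift_eq (hr : Function.Surjective G.r) {n : ℕ}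
    [NeZero n] {P : Set G.InfinitePath} (hP : IsOpen P) (hper : ∀ p ∈ P, G.shift^[n] p = p)
    {q : G.InfinitePath} (hq : q ∈ P) : G.r (q.1 0) ∈ G.cycleVertices n := by
  have hn : 0 < n := NeZero.pos n
  obtain ⟨U, m, hU, hqU, hUP⟩ := exists_cylinder_subset hP hq
  have hm : m + 1 ≤ n * (m + 1) := Nat.le_mul_of_pos_left _ hn
  obtain ⟨t, ht⟩ : ∃ t, t + 1 = 0 + n * (m + 1) := ⟨n * (m + 1) - 1, by omega⟩
  refine ⟨_, isOpen_chainSources G.continuous_r G.isLocalHomeomorph_s.isOpenMap hU t,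
    ⟨q.1, fun i _ => q.2 i, fun i _ => hqU i, ?_⟩, ?_⟩
  · rw [q.2, ht, apply_add_mul (hper q hq)]
  · rintro w ⟨f, hf, hfU, hfw⟩
    obtain ⟨e, he⟩ := hr w
    obtain ⟨y, rfl⟩ := exists_infinitePath hr e
    obtain ⟨x, hxf, hxy⟩ := exists_append hf (hfw.trans he.symm)
    have hxP : x ∈ P := hUP x fun i hi => by rw [hxf i (by omega)]; exact hfU i (by omega)
    obtain ⟨γ, hγ, hγe, hγx⟩ := exists_cycle_of_forall_iterate_shift_eq hr hP hper hxP
    refine ⟨γ, hγ, hγe, ?_⟩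
    rw [hγx, ← apply_add_mul (hper x hxP) 0 (m + 1), ← ht, ← zero_add (t + 1), hxy, he]

/-! ### The topology of the boundary path groupoid -/

/-- The injectivity required of the generators of the topology is not needed for openness, since the
shift is locally injective. -/
theorem isOpen_basicOpen {U W : Set G.InfinitePath} (hU : IsOpen U) (hW : IsOpen W) (k l : ℕ) :
    IsOpen (G.basicOpen U W k l) := by
  rw [isOpen_iff_forall_mem_open]
  rintro g ⟨hgU, hgW, hg⟩
  obtain ⟨U', hU', hgU', hinjU⟩ := exists_injOn_iterate_shift k g.range
  obtain ⟨W', hW', hgW', hinjW⟩ := exists_injOn_iterate_shift l g.source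
  refine ⟨G.basicOpen (U ∩ U') (W ∩ W') k l, fun h hh => ⟨hh.1.1, hh.2.1.1, hh.2.2⟩,
    TopologicalSpace.isOpen_generateFrom_of_mem ⟨_, _, k, l, hU.inter hU', hW.inter hW',
      hinjU.mono Set.inter_subset_right, hinjW.mono Set.inter_subset_right, rfl⟩,
    ⟨hgU, hgU'⟩, ⟨hgW, hgW'⟩, hg⟩

theorem basicOpen_subset_of_le {U W : Set G.InfinitePath} {k l k' l' : ℕ}
    (h : (k : ℤ) - l = (k' : ℤ) - l') (hl : l ≤ l') :
    G.basicOpen U W k l ⊆ G.basicOpen U W k' l' := by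
  rintro g ⟨hU, hW, hd, hs⟩
  obtain ⟨c, rfl⟩ := Nat.exists_eq_add_of_le' hl
  obtain rfl : k' = c + k := by omega
  exact ⟨hU, hW, hd.trans h, by
    rw [Function.iterate_add_apply, hs, ← Function.iterate_add_apply]⟩

/-- The sets `𝒰(U, W, k, l)` form a basis of the topology: at a common element of two of them the
degrees agree, so that the one with the smaller `l` imposes the stronger equation. -/
theorem exists_basicOpen_subset {A : Set G.BoundaryPathGroupoid} (hA : IsOpen A)
    {g : G.BoundaryPathGroupoid} (hg : g ∈ A) :
    ∃ (U W : Set G.InfinitePath) (k l : ℕ), IsOpen U ∧ IsOpen W ∧ g ∈ G.basicOpen U W k l ∧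
      G.basicOpen U W k l ⊆ A := by
  induction hA with
  | basic A hA =>
    obtain ⟨U, W, k, l, hU, hW, -, -, rfl⟩ := hA
    exact ⟨U, W, k, l, hU, hW, hg, subset_rfl⟩
  | univ =>
    obtain ⟨k, l, hd, hs⟩ := g.exists_shift_eq
    exact ⟨_, _, k, l, isOpen_univ, isOpen_univ, ⟨trivial, trivial, hd, hs⟩, Set.subset_univ _⟩
  | inter A B _ _ ihA ihB =>
    obtain ⟨U, W, k, l, hU, hW, hgA, hA⟩ := ihA hg.1
    obtain ⟨U', W', k', l', hU', hW', hgB, hB⟩ := ihB hg.2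
    have hd : (k : ℤ) - l = (k' : ℤ) - l' := hgA.2.2.1.symm.trans hgB.2.2.1
    rcases le_total l l' with hl | hl
    · refine ⟨U ∩ U', W ∩ W', k, l, hU.inter hU', hW.inter hW',
        ⟨⟨hgA.1, hgB.1⟩, ⟨hgA.2.1, hgB.2.1⟩, hgA.2.2⟩, fun h hh => ⟨hA ?_, hB ?_⟩⟩
      · exact ⟨hh.1.1, hh.2.1.1, hh.2.2⟩
      · exact basicOpen_subset_of_le hd hl ⟨hh.1.2, hh.2.1.2, hh.2.2⟩
    · refine ⟨U ∩ U', W ∩ W', k', l', hU.inter hU', hW.inter hW',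
        ⟨⟨hgA.1, hgB.1⟩, ⟨hgA.2.1, hgB.2.1⟩, hgB.2.2⟩, fun h hh => ⟨hA ?_, hB ?_⟩⟩
      · exact basicOpen_subset_of_le hd.symm hl ⟨hh.1.1, hh.2.1.1, hh.2.2⟩
      · exact ⟨hh.1.2, hh.2.1.2, hh.2.2⟩
  | sUnion S _ ih =>
    obtain ⟨A, hAS, hgA⟩ := hg
    obtain ⟨U, W, k, l, hU, hW, hgU, hA⟩ := ih A hAS hgA
    exact ⟨U, W, k, l, hU, hW, hgU, hA.trans (Set.subset_sUnion_of_mem hAS)⟩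

theorem BoundaryPathGroupoid.continuous_range :
    Continuous (BoundaryPathGroupoid.range : G.BoundaryPathGroupoid → G.InfinitePath) := by
  refine continuous_def.2 fun U hU => isOpen_iff_forall_mem_open.2 fun g hg => ?_
  obtain ⟨k, l, hkl⟩ := g.exists_shift_eq
  exact ⟨G.basicOpen U Set.univ k l, fun h hh => hh.1, isOpen_basicOpen hU isOpen_univ k l,
    hg, trivial, hkl⟩

theorem BoundaryPathGroupoid.continuous_source :
    Continuous (BoundaryPathGroupoid.source : G.BoundaryPathGroupoid → G.InfinitePath) := by
  refine continuous_def.2 fun W hW => isOpen_iff_forall_mem_open.2 fun g hg => ?_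
  obtain ⟨k, l, hkl⟩ := g.exists_shift_eq
  exact ⟨G.basicOpen Set.univ W k l, fun h hh => hh.2.1, isOpen_basicOpen isOpen_univ hW k l,
    trivial, hg, hkl⟩

theorem isClosed_isotropy : IsClosed G.isotropy :=
  isClosed_eq BoundaryPathGroupoid.continuous_range BoundaryPathGroupoid.continuous_source

/-- The inverse `(x, m, y) ↦ (y, -m, x)` of the groupoid. -/
def BoundaryPathGroupoid.inverse (g : G.BoundaryPathGroupoid) : G.BoundaryPathGroupoid where
  range := g.source
  degree := -g.degree
  source := g.range
  exists_shift_eq :=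
    let ⟨k, l, hd, hs⟩ := g.exists_shift_eq
    ⟨l, k, by omega, hs.symm⟩

theorem BoundaryPathGroupoid.involutive_inverse :
    Function.Involutive (inverse : G.BoundaryPathGroupoid → G.BoundaryPathGroupoid) := fun g => by
  ext1
  exacts [rfl, neg_neg _, rfl]

theorem BoundaryPathGroupoid.continuous_inverse :
    Continuous (inverse : G.BoundaryPathGroupoid → G.BoundaryPathGroupoid) := by
  refine continuous_generateFrom_iff.2 ?_
  rintro _ ⟨U, W, k, l, hU, hW, -, -, rfl⟩
  convert isOpen_basicOpen hW hU l k using 1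
  ext g
  have h1 : -g.degree = (k : ℤ) - l ↔ g.degree = (l : ℤ) - k := by omega
  simp only [basicOpen, inverse, Set.mem_preimage, Set.mem_ofPred_eq, h1,
    eq_comm (a := G.shift^[k] g.source)]
  tauto

theorem BoundaryPathGroupoid.mem_interior_isotropy_of_inverse {g : G.BoundaryPathGroupoid}
    (hg : g.inverse ∈ interior G.isotropy) : g ∈ interior G.isotropy := by
  have h : inverse ⁻¹' G.isotropy = G.isotropy := by
    ext g
    exact eq_comm
  rw [← h]
  exact preimage_interior_subset_interior_preimage continuous_inverse hg

/-! ### The interior of the isotropy -/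

theorem mem_interior_isotropy_of_degree_eq_zero {g : G.BoundaryPathGroupoid}
    (hg : g ∈ G.isotropy) (hd : g.degree = 0) : g ∈ interior G.isotropy :=
  mem_interior.2 ⟨G.basicOpen Set.univ Set.univ 0 0, fun _ h => h.2.2.2,
    isOpen_basicOpen isOpen_univ isOpen_univ 0 0, trivial, trivial, by simpa using hd, hg⟩

/-- If `(x, n, x)` is in the interior of the isotropy and `σˡ⁺ⁿ x = σˡ x`, then `r (σˡ x) ∈ Vₙ`, since
all infinite paths near `σˡ x` are `n`-periodic. -/
theorem r_mem_cycleVertices_of_mem_interior_isotropy (hr : Function.Surjective G.r) {n : ℕ}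
    [NeZero n] {g : G.BoundaryPathGroupoid} (hg : g ∈ interior G.isotropy) {l : ℕ}
    (hgl : g ∈ G.basicOpen Set.univ Set.univ (l + n) l) :
    G.r (g.range.1 l) ∈ G.cycleVertices n := by
  obtain ⟨A, hA, hAo, hgA⟩ := mem_interior.1 hg
  obtain ⟨U, W, k', l', hU, hW, hgU, hUA⟩ := exists_basicOpen_subset hAo hgA
  have hd : ((l + n : ℕ) : ℤ) - l = (k' : ℤ) - l' := hgl.2.2.1.symm.trans hgU.2.2.1
  obtain ⟨l₀, hl₀, hg₀, hA₀⟩ : ∃ l₀ ≤ l, g ∈ G.basicOpen U W (l₀ + n) l₀ ∧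
      G.basicOpen U W (l₀ + n) l₀ ⊆ G.isotropy := by
    rcases le_total l l' with h | h
    · exact ⟨l, le_rfl, ⟨hgU.1, hgU.2.1, hgl.2.2⟩,
        (basicOpen_subset_of_le hd h).trans (hUA.trans hA)⟩
    · obtain rfl : k' = l' + n := by omega
      exact ⟨l', h, hgU, hUA.trans hA⟩
  have hgI : g ∈ G.isotropy := interior_subset hg
  have hgiso : g.range = g.source := hgI
  obtain ⟨c, rfl⟩ := Nat.exists_eq_add_of_le' hl₀
  -- Near `σ^l₀ x`, every path is of the form `σ^(l₀ + n) x' = σ^l₀ y'` with `x' ∈ U` and `y' ∈ W`, so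
  -- that `x' = y'`; the shift then carries this periodicity over to a neighbourhood of `σˡ x`.
  have hP : IsOpen (G.shift^[c] '' (G.shift^[l₀ + n] '' U ∩ G.shift^[l₀] '' W)) :=
    (isOpenMap_iterate_shift c) _
      (((isOpenMap_iterate_shift _) _ hU).inter ((isOpenMap_iterate_shift _) _ hW))
  have hq : G.shift^[c + l₀] g.range ∈
      G.shift^[c] '' (G.shift^[l₀ + n] '' U ∩ G.shift^[l₀] '' W) :=
    ⟨G.shift^[l₀] g.range, ⟨⟨g.range, hg₀.1, hg₀.2.2.2.trans (by rw [hgiso])⟩,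
      ⟨g.source, hg₀.2.1, by rw [hgiso]⟩⟩, (Function.iterate_add_apply _ _ _ _).symm⟩
  have := mem_cycleVertices_of_forall_iterate_shift_eq hr (n := n) hP ?_ hq
  · rwa [iterate_shift_apply, zero_add] at this
  · rintro _ ⟨_, ⟨⟨x, hx, rfl⟩, ⟨y, hy, hxy⟩⟩, rfl⟩
    have hxy' : x = y := hA₀ (a := ⟨x, n, y, l₀ + n, l₀, by push_cast; ring, hxy.symm⟩)
      ⟨hx, hy, by push_cast; ring, hxy.symm⟩
    subst hxy'
    rw [← Function.iterate_add_apply, Nat.add_comm n c, Function.iterate_add_apply, ← hxy,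
      ← Function.iterate_add_apply G.shift n l₀, Nat.add_comm n l₀, ← hxy]

/-- If `σˡ⁺ⁿ x = σˡ x` and `r (σˡ x) ∈ Vₙ`, then `(x, n, x)` is in the interior of the isotropy. -/
theorem mem_interior_isotropy_of_r_mem_cycleVertices {n : ℕ} [NeZero n]
    {g : G.BoundaryPathGroupoid} (hg : g ∈ G.isotropy) {l : ℕ}
    (hgl : g ∈ G.basicOpen Set.univ Set.univ (l + n) l)
    (hgV : G.r (g.range.1 l) ∈ G.cycleVertices n) : g ∈ interior G.isotropy := by
  obtain ⟨U, hU, hgU, hinj⟩ := exists_injOn_iterate_shift l g.range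
  refine mem_interior.2 ⟨_, ?_, isOpen_basicOpen (hU.inter ((isOpen_cycleVertices n).preimage
    (G.continuous_r.comp (continuous_infinitePath_apply l)))) hU (l + n) l,
    ⟨hgU, hgV⟩, (show g.range = g.source from hg) ▸ hgU, hgl.2.2⟩
  rintro h ⟨⟨hU1, hV⟩, hU2, -, hs⟩
  refine hinj hU1 hU2 ?_
  have hper : G.shift^[n] (G.shift^[l] h.range) = G.shift^[l] h.range :=
    iterate_shift_eq_self_of_mem_cycleVertices (by
      rw [iterate_shift_apply, zero_add]
      exact hV)
  rw [← hper, ← Function.iterate_add_apply, Nat.add_comm, hs]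

theorem mem_interior_isotropy_of_mem_closure (hr : Function.Surjective G.r) {n : ℕ} [NeZero n]
    (hV : IsClosed (G.cycleVertices n)) {g : G.BoundaryPathGroupoid} (hd : g.degree = n)
    (hg : g ∈ closure (interior G.isotropy)) : g ∈ interior G.isotropy := by
  obtain ⟨k, l, hkl, hs⟩ := g.exists_shift_eq
  obtain rfl : k = l + n := by omega
  have hgl : g ∈ G.basicOpen Set.univ Set.univ (l + n) l := ⟨trivial, trivial, hkl, hs⟩
  refine mem_interior_isotropy_of_r_mem_cycleVertices
    (closure_minimal interior_subset isClosed_isotropy hg) hgl ?_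
  have h1 := (isOpen_basicOpen isOpen_univ isOpen_univ (l + n) l).inter_closure ⟨hgl, hg⟩
  have h2 : Continuous fun h : G.BoundaryPathGroupoid => G.r (h.range.1 l) :=
    G.continuous_r.comp ((continuous_infinitePath_apply l).comp
      BoundaryPathGroupoid.continuous_range)
  have h3 : Set.MapsTo (fun h : G.BoundaryPathGroupoid => G.r (h.range.1 l))
      (G.basicOpen Set.univ Set.univ (l + n) l ∩ interior G.isotropy) (G.cycleVertices n) :=
    fun h hh => r_mem_cycleVertices_of_mem_interior_isotropy hr hh.2 hh.1
  exact hV.closure_eq ▸ h3.closure h2 h1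

theorem isClosed_interior_isotropy (hr : Function.Surjective G.r)
    (hV : ∀ (n : ℕ) [NeZero n], IsClosed (G.cycleVertices n)) :
    IsClosed (interior G.isotropy) := by
  refine isClosed_of_closure_subset fun g hg => ?_
  have hgI : g ∈ G.isotropy := closure_minimal interior_subset isClosed_isotropy hg
  obtain ⟨n, hn | hn⟩ := g.degree.eq_nat_or_neg
  all_goals rcases eq_or_ne n 0 with rfl | hn0
  · exact mem_interior_isotropy_of_degree_eq_zero hgI hn
  · have : NeZero n := ⟨hn0⟩
    exact mem_interior_isotropy_of_mem_closure hr (hV n) hn hg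
  · exact mem_interior_isotropy_of_degree_eq_zero hgI (by simpa using hn)
  · have : NeZero n := ⟨hn0⟩
    have hinv : Set.MapsTo BoundaryPathGroupoid.inverse (interior G.isotropy)
        (interior G.isotropy) := fun h hh =>
      BoundaryPathGroupoid.mem_interior_isotropy_of_inverse
        (by rwa [BoundaryPathGroupoid.involutive_inverse h])
    refine BoundaryPathGroupoid.mem_interior_isotropy_of_inverse
      (mem_interior_isotropy_of_mem_closure hr (hV n) ?_
        (hinv.closure BoundaryPathGroupoid.continuous_inverse hg))
    change -g.degree = n
    omega

end TopologicalGraph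

theorem theorem3p7 {V E : Type*} [TopologicalSpace V] [LocallyCompactSpace V] [T2Space V]
    [TopologicalSpace E] [LocallyCompactSpace E] [T2Space E] (G : TopologicalGraph V E) :
    (∀ (n : ℕ) [NeZero n],
      G.pathRange '' G.B n = G.cycleVertices n ∧
      G.B n = G.pathRange ⁻¹' G.cycleVertices n ∧
      IsOpen (G.B n)) ∧
    (G.singularVertices = ∅ →
      (∀ (n : ℕ) [NeZero n], IsClosed (G.B n) ↔ IsClosed (G.cycleVertices n)) ∧
      ((∀ (n : ℕ) [NeZero n], IsClosed (G.B n)) → IsClosed (interior G.isotropy))) := by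
  refine ⟨fun n _ => ⟨TopologicalGraph.image_B n, TopologicalGraph.B_eq_preimage n, ?_⟩,
    fun hG => ⟨fun n _ => TopologicalGraph.isClosed_B_iff hG n, fun h =>
      TopologicalGraph.isClosed_interior_isotropy (TopologicalGraph.surjective_r hG) fun n _ =>
        (TopologicalGraph.isClosed_B_iff hG n).1 (h n)⟩⟩
  rw [TopologicalGraph.B_eq_preimage]
  exact (TopologicalGraph.isOpen_cycleVertices n).preimage TopologicalGraph.continuous_pathRange
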